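/- Let $\mathcal G=(\mathcal V,\mathcal E)$ be a finite undirected graph without self-loops, let $\mathcal N_i$ be the set of neighbors of node $i$, and for every $i\in\mathcal V$ let $f_i:\mathbb R^{n(|\mathcal N_i|+1)}\to\mathbb R\cup\{+\infty\}$ be closed, proper and convex. Consider the partition-based problem $$\min_{x_i\in\mathbb R^n,\ i\in\mathcal V}\ \sum_{i\in\mathcal V} f_i\big(x_i,\{x_j\}_{j\in\mathcal N_i}\big)\qquad(1)$$ and its reformulation with local copies $\mathbf x^{(i)}=\big(x_i^{(i)},\{x_j^{(i)}\}_{j\in\mathcal N_i}\big)$ and bridge variables $y_i^{(i,j)},y_j^{(i,j)}$ (for every ordered pair $(i,j)$ of adjacent nodes): minimize $\sum_i f_i(\mathbf x^{(i)})$ subject to $x_i^{(i)}=y_i^{(i,j)}$, $x_j^{(i)}=y_j^{(i,j)}$, $y_i^{(i,j)}=y_i^{(j,i)}$, $y_j^{(i,j)}=y_j^{(j,i)}$. Write it as $\min_{\mathbf x,\mathbf y}\ F(\mathbf x)+\iota_{(I-P)}(\mathbf y)$ subject to $A\mathbf x+\mathbf y=0$, where $F(\mathbf x)=\sum_i f_i(\mathbf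 x^{(i)})$, the entries of $A\mathbf x$ at $(i,j)$ are $-x_i^{(i)},-x_j^{(i)}$, $P$ is the permutation that swaps $y_i^{(i,j)}$ with $y_i^{(j,i)}$, and $\iota_{(I-P)}(\mathbf y)$ is $0$ if $\mathbf y=P\mathbf y$ and $+\infty$ otherwise. Assume that this problem has a primal-dual solution, i.e. that its Lagrangian $F(\mathbf x)+\iota_{(I-P)}(\mathbf y)-\mathbf w^\top(A\mathbf x+\mathbf y)$ has a saddle point. Let $0<\alpha<1$ and $\rho>0$. The modified partition-based R-ADMM with reliable communication is the following iteration, for $k=0,1,2,\dots$. Every node $i$ computes $$\mathbf x^{(i)}(k)\in\operatorname*{arg\,min}_{x_i^{(i)},\{x_j^{(i)}\}}\Big\{f_i\big(x_i^{(i)},\{x_j^{(i)}\}_{j\in\mathcal N_i}\big)-\Big(\sum_{j\in\mathcal N_i}z_i^{(j,i)}(k)\Big)^{\!\top}x_i^{(i)}-\sum_{j\in\mathcal N_i}z_j^{(j,i)}(k)^\top x_j^{(i)}+\frac\rho2|\mathcal N_i|\|x_i^{(i)}\|^2+\frac\rho2\sum_{j\in\mathcal N_i}\|x_j^{(i)}\|^2\Big\},$$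 sends $q_i^{(i\to j)}=-z_i^{(j,i)}(k)+2\rho x_i^{(i)}(k)$ and $q_j^{(i\to j)}=-z_j^{(j,i)}(k)+2\rho x_j^{(i)}(k)$ to each $j\in\mathcal N_i$, receives $q_i^{(j\to i)},q_j^{(j\to i)}$, and sets $$z_i^{(j,i)}(k+1)=(1-\alpha)z_i^{(j,i)}(k)+\alpha q_i^{(j\to i)},\qquad z_j^{(j,i)}(k+1)=(1-\alpha)z_j^{(j,i)}(k)+\alpha q_j^{(j\to i)}.$$ Then, for every initial condition $z(0)$, the algorithm can be run (all the minimizations have solutions), and every trajectory that it generates converges to the optimal solution of (1): (a) if (1) has a unique optimal solution $\mathbf x^*$, then $\lim_{k\to\infty}x_i^{(i)}(k)=x_i^*$ and $\lim_{k\to\infty}x_j^{(i)}(k)=x_j^*$ for all $i\in\mathcal V$ and $j\in\mathcal N_i$; (b) if the optimal solution is not assumed unique, but for every node without neighbors $f_i$ has at most one minimizer, then for every trajectory there is an optimal solution $\mathbf x^*$ of (1) (possibly depending on the trajectory) for which the limits in (a) hold. -/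

import Mathlib

open Filter Topology

noncomputable section

namespace PartitionADMM

/-- The space `ℝⁿ` in which every node variable lives (Euclidean norm). -/
abbrev E (n : ℕ) : Type := EuclideanSpace ℝ (Fin n)

/-! ### Extended-real-valued convex functions -/

section Functions

variable {X : Type*} [AddCommGroup X] [Module ℝ X] [TopologicalSpace X]

/-- `f : X → ℝ ∪ {+∞}` is closed, proper and convex: it never takes the value `-∞`, it is not
identically `+∞`, its real sublevel sets are closed, and its epigraph is convex. -/
structure ClosedProperConvex (f : X → EReal) : Prop where
  ne_bot : ∀ u, f u ≠ ⊥
  exists_ne_top : ∃ u, f u ≠ ⊤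
  isClosed_sublevel : ∀ a : ℝ, IsClosed {u | f u ≤ (a : EReal)}
  convex_epigraph : Convex ℝ {p : X × ℝ | f p.1 ≤ (p.2 : EReal)}

end Functions

/-- `u` is a (global) minimizer of `f`, that is, `u ∈ argmin f`. -/
def IsArgmin {X : Type*} (f : X → EReal) (u : X) : Prop := ∀ v, f u ≤ f v

section Network

variable {V : Type*} [Fintype V] (G : SimpleGraph V) [DecidableRel G.Adj] (n : ℕ)

/-- The vector `(u_i, {u_j}_{j ∈ N_i})` of the variables on which the cost of node `i` depends:
the first component belongs to `i`, the second one to the neighbors of `i`. -/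
abbrev LocalVec (i : V) : Type _ := E n × (G.neighborSet i → E n)

/-- All local copies: `(x i).1` is `x_i^{(i)}` and `(x i).2 j` is `x_j^{(i)}`. -/
abbrev Copies : Type _ := (i : V) → LocalVec G n i

/-- Edge variables. For adjacent `i` and `j`, the value at the ordered edge `(i, j)` is the pair
`(z_i^{(i,j)}, z_j^{(i,j)})`; the value at `(j, i)` is the pair `(z_j^{(j,i)}, z_i^{(j,i)})`. -/
abbrev EdgeVec : Type _ := G.Dart → E n × E n

variable {G n}

/-! ### The partition-based problem -/

/-- The cost `∑ i, f_i (x_i, {x_j}_{j ∈ N_i})` of the partition-based problem. -/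
def partitionCost (f : (i : V) → LocalVec G n i → EReal) (x : V → E n) : EReal :=
  ∑ i, f i (x i, fun j => x j)

/-- `x` is an optimal solution of the partition-based problem
(with a finite optimal value). -/
def IsOptimal (f : (i : V) → LocalVec G n i → EReal) (x : V → E n) : Prop :=
  partitionCost f x ≠ ⊤ ∧ ∀ x', partitionCost f x ≤ partitionCost f x'

/-! ### Reformulation with local copies and bridge variables -/

/-- The separable cost `F(x) = ∑ i, f_i (x^{(i)})` of the local copies. -/
def copiesCost (f : (i : V) → LocalVec G n i → EReal) (x : Copies G n) : EReal :=
  ∑ i, f i (x i)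

/-- The linear map `A`: the rows of `A x` at the edge `(i, j)` are `-x_i^{(i)}`, `-x_j^{(i)}`, so
that `A x + y = 0` says `x_i^{(i)} = y_i^{(i,j)}` and `x_j^{(i)} = y_j^{(i,j)}`. -/
def edgeMap (x : Copies G n) : EdgeVec G n :=
  fun d => (-(x d.fst).1, -(x d.fst).2 ⟨d.snd, d.adj⟩)

/-- The permutation `P` that swaps `y_i^{(i,j)}` with `y_i^{(j,i)}`. -/
def swapEdges (y : EdgeVec G n) : EdgeVec G n :=
  fun d => ((y d.symm).2, (y d.symm).1)

/-- The Euclidean inner product of two edge vectors. -/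
def edgeInner (w y : EdgeVec G n) : ℝ :=
  ∑ d, (inner ℝ (w d).1 (y d).1 + inner ℝ (w d).2 (y d).2)

open Classical in
/-- The indicator function of `{y | y = P y}`. -/
def bridgeIndicator (y : EdgeVec G n) : EReal := if y = swapEdges y then 0 else ⊤

/-- The Lagrangian `F(x) + ι_{I-P}(y) - ⟨w, A x + y⟩` of the problem
`min F(x) + ι_{I-P}(y)` subject to `A x + y = 0`. -/
def lagrangian (f : (i : V) → LocalVec G n i → EReal)
    (x : Copies G n) (y w : EdgeVec G n) : EReal :=
  copiesCost f x + bridgeIndicator y + ((-edgeInner w (edgeMap x + y) : ℝ) : EReal)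

/-- `(x, y; w)` is a saddle point of the Lagrangian (a primal-dual solution). -/
def IsSaddlePoint (f : (i : V) → LocalVec G n i → EReal)
    (x : Copies G n) (y w : EdgeVec G n) : Prop :=
  (∀ w', lagrangian f x y w' ≤ lagrangian f x y w) ∧
    ∀ x' y', lagrangian f x y w ≤ lagrangian f x' y' w

/-! ### The algorithm -/

/-- The function minimized by node `i` in the `x`-update, where `z` holds the current auxiliary
variables. For `j ∈ N_i` the component `.2` at the edge `(j, i)` is `z_i^{(j,i)}` and the
component `.1` is `z_j^{(j,i)}`. -/
def localObjective (f : (i : V) → LocalVec G n i → EReal) (ρ : ℝ) (z : EdgeVec G n) (i : V)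
    (u : LocalVec G n i) : EReal :=
  f i u +
    ((-inner ℝ (∑ j : G.neighborSet i, (z ⟨(↑j, i), SimpleGraph.Adj.symm j.2⟩).2) u.1
      - ∑ j : G.neighborSet i, inner ℝ (z ⟨(↑j, i), SimpleGraph.Adj.symm j.2⟩).1 (u.2 j)
      + ρ / 2 * (G.degree i : ℝ) * ‖u.1‖ ^ 2
      + ρ / 2 * ∑ j : G.neighborSet i, ‖u.2 j‖ ^ 2 : ℝ) : EReal)

/-- `x` and `z` are trajectories of the modified partition-based R-ADMM with reliable
communication, with transmitted packets `q`. The packet sent from `i` to `j` at time `k` is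
`q k (i, j) = (q_i^{(i → j)}, q_j^{(i → j)})`. -/
structure IsRun (f : (i : V) → LocalVec G n i → EReal) (α ρ : ℝ)
    (x : ℕ → Copies G n) (z q : ℕ → EdgeVec G n) : Prop where
  /-- every node `i` computes `x^{(i)}(k)` -/
  x_update : ∀ k i, IsArgmin (localObjective f ρ (z k) i) (x k i)
  /-- `q_i^{(i → j)} = -z_i^{(j,i)}(k) + 2 ρ x_i^{(i)}(k)`, computed by node `i` -/
  q_own : ∀ k i j (h : G.Adj i j),
    (q k ⟨(i, j), h⟩).1 = -(z k ⟨(j, i), h.symm⟩).2 + (2 * ρ) • (x k i).1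
  /-- `q_j^{(i → j)} = -z_j^{(j,i)}(k) + 2 ρ x_j^{(i)}(k)`, computed by node `i` -/
  q_nbr : ∀ k i j (h : G.Adj i j),
    (q k ⟨(i, j), h⟩).2 = -(z k ⟨(j, i), h.symm⟩).1 + (2 * ρ) • (x k i).2 ⟨j, h⟩
  /-- `z_i^{(j,i)}(k+1) = (1-α) z_i^{(j,i)}(k) + α q_i^{(j → i)}`, computed by node `i` -/
  z_own : ∀ k i j (h : G.Adj i j),
    (z (k + 1) ⟨(j, i), h.symm⟩).2 =
      (1 - α) • (z k ⟨(j, i), h.symm⟩).2 + α • (q k ⟨(j, i), h.symm⟩).2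
  /-- `z_j^{(j,i)}(k+1) = (1-α) z_j^{(j,i)}(k) + α q_j^{(j → i)}`, computed by node `i` -/
  z_nbr : ∀ k i j (h : G.Adj i j),
    (z (k + 1) ⟨(j, i), h.symm⟩).1 =
      (1 - α) • (z k ⟨(j, i), h.symm⟩).1 + α • (q k ⟨(j, i), h.symm⟩).1

/-- Every local copy converges to the corresponding component of `xs`:
`x_i^{(i)}(k) → xs_i` for every node `i`, and `x_j^{(i)}(k) → xs_j` for every `j ∈ N_i`. -/
def CopiesTendTo (x : ℕ → Copies G n) (xs : V → E n) : Prop :=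
  ∀ i, Tendsto (fun k => (x k i).1) atTop (𝓝 (xs i)) ∧
    ∀ j : G.neighborSet i, Tendsto (fun k => (x k i).2 j) atTop (𝓝 (xs j))

end Network

end PartitionADMM

end

namespace PartitionADMM

/-! ### Averaged iterations of nonexpansive maps. -/

section Averaged

variable {H : Type*} [NormedAddCommGroup H] [InnerProductSpace ℝ H]

/-! The algorithm is an averaged fixed-point iteration in the variable `ζ = P z`. The local
optimality condition says that `ζ + ρ A x` is a subgradient of the cost at `x`, so monotonicity
makes `ζ ↦ -ρ A x` firmly nonexpansive. Its reflection `ζ ↦ -2 ρ A x - ζ`, followed by the isometry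
`P`, is therefore a nonexpansive map `T` (`norm_reflection_sub_le`), and the update reads `ζ ↦ (1 -
α) ζ + α T ζ`. A saddle point yields the fixed point `-w - ρ A x`, so Krasnoselskii–Mann applies.

At the limit, `T ζ = ζ` forces `P (A x) = A x`, which is consensus, and `P s = -s` for the
subgradient `s = ζ + ρ A x`. Such an `s` is orthogonal to consensual directions, so the subgradient
inequalities add up to optimality. Since `A x` is Lipschitz in `ζ`, the copies converge on every
edge. Nodes without neighbors are invisible to `A`; there, uniqueness of the minimizer makes the
copy constant. -/

theorem norm_sq_average (α : ℝ) (a b : H) :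
    ‖(1 - α) • a + α • b‖ ^ 2 =
      (1 - α) * ‖a‖ ^ 2 + α * ‖b‖ ^ 2 - α * (1 - α) * ‖b - a‖ ^ 2 := by
  rw [norm_add_sq_real, norm_sub_sq_real, norm_smul, norm_smul, mul_pow, mul_pow,
    inner_smul_left, inner_smul_right, Real.norm_eq_abs, Real.norm_eq_abs, sq_abs, sq_abs,
    real_inner_comm a b]
  simp only [conj_trivial]
  ring

/-- The Krasnoselskii–Mann theorem in finite dimension: averaged iterations of a nonexpansive map
with a fixed point converge to a fixed point. -/
theorem exists_tendsto_averaged_iteration [FiniteDimensional ℝ H] {T : H → H}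
    (hT : ∀ a b, ‖T a - T b‖ ≤ ‖a - b‖) {p : H} (hp : T p = p) {α : ℝ} (hα0 : 0 < α)
    (hα1 : α < 1) {ζ : ℕ → H} (hζ : ∀ k, ζ (k + 1) = (1 - α) • ζ k + α • T (ζ k)) :
    ∃ l, T l = l ∧ Tendsto ζ atTop (𝓝 l) := by
  have : ProperSpace H := FiniteDimensional.proper ℝ H
  have key : ∀ c, T c = c → ∀ k,
      ‖ζ (k + 1) - c‖ ^ 2 ≤ ‖ζ k - c‖ ^ 2 - α * (1 - α) * ‖T (ζ k) - ζ k‖ ^ 2 := by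
    intro c hc k
    have h1 : ζ (k + 1) - c = (1 - α) • (ζ k - c) + α • (T (ζ k) - c) := by
      rw [hζ]; module
    have h2 : ‖T (ζ k) - c‖ ^ 2 ≤ ‖ζ k - c‖ ^ 2 := by
      have := hT (ζ k) c
      rw [hc] at this
      gcongr
    rw [h1, norm_sq_average, sub_sub_sub_cancel_right]
    nlinarith
  have hpos : 0 < α * (1 - α) := mul_pos hα0 (by linarith)
  have anti : ∀ c, T c = c → Antitone fun k => ‖ζ k - c‖ ^ 2 := fun c hc =>
    antitone_nat_of_succ_le fun k =>
      (key c hc k).trans (sub_le_self _ (mul_nonneg hpos.le (sq_nonneg _)))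
  obtain ⟨d, hd⟩ : ∃ d, Tendsto (fun k => ‖ζ k - p‖ ^ 2) atTop (𝓝 d) :=
    ⟨_, tendsto_atTop_ciInf (anti p hp) ⟨0, by rintro _ ⟨k, rfl⟩; positivity⟩⟩
  -- The residual is bounded by the decrements of a convergent sequence.
  have hres : Tendsto (fun k => ‖T (ζ k) - ζ k‖ ^ 2) atTop (𝓝 0) := by
    have h1 : Tendsto (fun k => (‖ζ k - p‖ ^ 2 - ‖ζ (k + 1) - p‖ ^ 2) / (α * (1 - α)))
        atTop (𝓝 0) := by
      simpa using (hd.sub (hd.comp (tendsto_add_atTop_nat 1))).div_const (α * (1 - α))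
    refine squeeze_zero (fun k => by positivity) (fun k => ?_) h1
    rw [le_div_iff₀ hpos]
    linarith [key p hp k]
  have hbdd : ∀ k, ζ k ∈ Metric.closedBall p ‖ζ 0 - p‖ := by
    intro k
    rw [mem_closedBall_iff_norm]
    exact le_of_sq_le_sq (anti p hp (Nat.zero_le k)) (norm_nonneg _)
  obtain ⟨l, -, φ, hφ, hl⟩ := tendsto_subseq_of_bounded Metric.isBounded_closedBall hbdd
  have hTc : Continuous T :=
    (LipschitzWith.of_dist_le_mul (K := 1) fun a b => by
      simpa [dist_eq_norm] using hT a b).continuous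
  have hTl : T l = l := by
    have h1 : Tendsto (fun k => ‖T (ζ (φ k)) - ζ (φ k)‖ ^ 2) atTop (𝓝 (‖T l - l‖ ^ 2)) :=
      ((((hTc.tendsto l).comp hl).sub hl).norm).pow 2
    have h2 := tendsto_nhds_unique h1 (hres.comp hφ.tendsto_atTop)
    simpa [sub_eq_zero] using h2
  refine ⟨l, hTl, ?_⟩
  -- As `l` is a fixed point, the distance to it is antitone, so a subsequence decides the limit.
  have h1 : Tendsto (fun k => ‖ζ k - l‖ ^ 2) atTop (𝓝 0) := by
    rw [tendsto_iff_tendsto_subseq_of_antitone (anti l hTl) hφ.tendsto_atTop]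
    have := ((hl.sub_const l).norm).pow 2
    simpa [Function.comp_def] using this
  rw [tendsto_iff_norm_sub_tendsto_zero]
  have h2 := h1.sqrt
  simpa [Real.sqrt_sq (norm_nonneg _)] using h2

end Averaged

/-! ### Finite sums of extended reals. -/

section ExtendedReal

variable {ι : Type*} [Fintype ι] {a : ι → EReal}

theorem sum_eq_coe {r : ι → ℝ} (h : ∀ i, a i = r i) : ∑ i, a i = ((∑ i, r i : ℝ) : EReal) := by
  simp_rw [h]
  induction (Finset.univ : Finset ι) using Finset.cons_induction with
  | empty => simp
  | cons i s hi ih => rw [Finset.sum_cons, Finset.sum_cons, ih, EReal.coe_add]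

/-- The exclusion of `⊥` is needed because `⊤ + ⊥ = ⊥` in `EReal`. -/
theorem sum_eq_top (hb : ∀ i, a i ≠ ⊥) {i : ι} (hi : a i = ⊤) : ∑ i, a i = ⊤ := by
  classical
  have h : ∀ s : Finset ι, ∑ j ∈ s, a j ≠ ⊥ := fun s => by
    induction s using Finset.cons_induction with
    | empty => simp
    | cons j s hj ih => rw [Finset.sum_cons, Ne, EReal.add_eq_bot_iff, not_or]; exact ⟨hb j, ih⟩
  rw [← Finset.add_sum_erase _ _ (Finset.mem_univ i), hi, EReal.top_add_of_ne_bot (h _)]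

theorem exists_coe_of_sum_ne_top (hb : ∀ i, a i ≠ ⊥) (ht : ∑ i, a i ≠ ⊤) :
    ∃ r : ι → ℝ, ∀ i, a i = r i :=
  ⟨fun i => (a i).toReal, fun i =>
    (EReal.coe_toReal (fun h => ht (sum_eq_top hb h)) (hb i)).symm⟩

end ExtendedReal

/-! ### Existence of minimizers and first-order conditions. -/

section Minimization

variable {X : Type*}

theorem ClosedProperConvex.exists_coe [AddCommGroup X] [Module ℝ X] [TopologicalSpace X]
    {f : X → EReal} (hf : ClosedProperConvex f) {u : X} (hu : f u ≠ ⊤) : ∃ r : ℝ, f u = r :=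
  ⟨_, (EReal.coe_toReal hu (hf.ne_bot u)).symm⟩

theorem ClosedProperConvex.ne_top_of_isArgmin_add [AddCommGroup X] [Module ℝ X]
    [TopologicalSpace X] {f : X → EReal} (hf : ClosedProperConvex f) {g : X → ℝ} {u : X}
    (hu : IsArgmin (fun w => f w + (g w : EReal)) u) : f u ≠ ⊤ := by
  intro h
  obtain ⟨v, hv⟩ := hf.exists_ne_top
  obtain ⟨b, hb⟩ := hf.exists_coe hv
  have := hu v
  simp only [h, hb, EReal.top_add_coe, top_le_iff, ← EReal.coe_add] at this
  exact EReal.coe_ne_top _ this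

/-- First-order optimality condition for the sum of a convex function and a function with a
quadratic upper bound along the segment from the minimizer. -/
theorem ClosedProperConvex.le_of_isArgmin_add [AddCommGroup X] [Module ℝ X] [TopologicalSpace X]
    {f : X → EReal} (hf : ClosedProperConvex f) {g : X → ℝ} {u v : X} {D C : ℝ}
    (hu : IsArgmin (fun w => f w + (g w : EReal)) u)
    (hg : ∀ t : ℝ, 0 < t → t ≤ 1 → g (u + t • (v - u)) ≤ g u + t * D + t ^ 2 * C) :
    f u + ((-D : ℝ) : EReal) ≤ f v := by
  rcases eq_or_ne (f v) ⊤ with hv | hv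
  · rw [hv]; exact le_top
  obtain ⟨a, ha⟩ := hf.exists_coe (hf.ne_top_of_isArgmin_add hu)
  obtain ⟨b, hb⟩ := hf.exists_coe hv
  -- Compare the minimizer with a point of the segment, bound `f` there by its chord, and divide by
  -- `t`.
  have key : ∀ t : ℝ, 0 < t → t ≤ 1 → 0 ≤ (b - a + D) + t * C := by
    intro t ht0 ht1
    have hc := hf.convex_epigraph (x := (u, a)) ha.le (y := (v, b)) hb.le
      (sub_nonneg.2 ht1) ht0.le (by ring)
    have he : (1 - t) • (u, a) + t • (v, b) = (u + t • (v - u), a + t * (b - a)) := by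
      ext
      · simp only [Prod.fst_add, Prod.smul_fst]; module
      · simp only [Prod.snd_add, Prod.smul_snd, smul_eq_mul]; ring
    rw [he] at hc
    have h1 : ((a + g u : ℝ) : EReal) ≤ ((a + t * (b - a) + g (u + t • (v - u)) : ℝ) : EReal) := by
      rw [EReal.coe_add, EReal.coe_add, ← ha]
      exact (hu _).trans (add_le_add_left hc _)
    have h2 := EReal.coe_le_coe_iff.1 h1
    have h3 : 0 ≤ t * ((b - a + D) + t * C) := by nlinarith [hg t ht0 ht1]
    exact nonneg_of_mul_nonneg_right h3 ht0
  have hlim : Tendsto (fun t : ℝ => (b - a + D) + t * C) (𝓝[>] 0) (𝓝 (b - a + D)) := by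
    have : Continuous fun t : ℝ => (b - a + D) + t * C := by fun_prop
    simpa using (this.tendsto 0).mono_left nhdsWithin_le_nhds
  have h0 : 0 ≤ b - a + D := by
    refine ge_of_tendsto hlim ?_
    filter_upwards [Ioc_mem_nhdsGT (zero_lt_one' ℝ)] with t ht using key t ht.1 ht.2
  rw [ha, hb, ← EReal.coe_add, EReal.coe_le_coe_iff]
  linarith

theorem ClosedProperConvex.lowerSemicontinuous [AddCommGroup X] [Module ℝ X]
    [TopologicalSpace X] {f : X → EReal} (hf : ClosedProperConvex f) :
    LowerSemicontinuous f := by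
  rw [lowerSemicontinuous_iff_isClosed_preimage]
  intro y
  induction y with
  | bot =>
    convert isClosed_empty
    ext u
    simpa using hf.ne_bot u
  | coe a => exact hf.isClosed_sublevel a
  | top => simp

/-- A closed proper convex function with an affine minorant attains the minimum of its sum with a
continuous function of quadratic growth. -/
theorem ClosedProperConvex.exists_isArgmin_add [NormedAddCommGroup X] [NormedSpace ℝ X]
    [FiniteDimensional ℝ X] {f : X → EReal} (hf : ClosedProperConvex f) {g : X → ℝ}
    (hg : Continuous g) {L M : X →ₗ[ℝ] ℝ} {c ρ : ℝ} (hρ : 0 < ρ)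
    (hfL : ∀ u, ((c + L u : ℝ) : EReal) ≤ f u) (hgM : ∀ u, M u + ρ * ‖u‖ ^ 2 ≤ g u) :
    ∃ u, IsArgmin (fun w => f w + (g w : EReal)) u := by
  have : ProperSpace X := FiniteDimensional.proper ℝ X
  obtain ⟨u₀, hu₀⟩ := hf.exists_ne_top
  obtain ⟨a, ha⟩ := hf.exists_coe hu₀
  set N : X →L[ℝ] ℝ := (L + M).toContinuousLinearMap with hN
  set K := ‖N‖
  set m := a + g u₀ - c with hm
  -- Beyond this radius the quadratic term beats the linear one and the value exceeds that at `u₀`.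
  -- The `+ 1` gives `1 ≤ ‖v‖`; the maximum keeps `u₀` in the ball.
  set R := max ‖u₀‖ ((K + |m|) / ρ + 1) with hR
  have hlsc : LowerSemicontinuous fun w => f w + (g w : EReal) :=
    hf.lowerSemicontinuous.add'
      (continuous_coe_real_ereal.comp hg).lowerSemicontinuous
      fun w => EReal.continuousAt_add (Or.inr (EReal.coe_ne_bot _)) (Or.inr (EReal.coe_ne_top _))
  obtain ⟨u, -, hu⟩ := LowerSemicontinuousOn.exists_isMinOn
    (s := Metric.closedBall (0 : X) R) ⟨u₀, by simp [hR]⟩ (isCompact_closedBall 0 R)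
    (hlsc.lowerSemicontinuousOn _)
  refine ⟨u, fun v => ?_⟩
  rcases le_or_gt ‖v‖ R with hv | hv
  · exact hu (by simpa using hv)
  refine (hu (show u₀ ∈ Metric.closedBall (0 : X) R by simp [hR])).trans ?_
  have h1 : a + g u₀ ≤ c + L v + g v := by
    have hNv : -(K * ‖v‖) ≤ L v + M v := by
      have := N.le_opNorm v
      rw [Real.norm_eq_abs] at this
      have h2 : N v = L v + M v := by simp [hN]
      exact h2 ▸ (abs_le.1 this).1
    have h3 : (K + |m|) / ρ + 1 < ‖v‖ := (le_max_right _ _).trans_lt hv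
    have h4 : 0 ≤ (K + |m|) / ρ := by positivity
    have h5 : K + |m| ≤ ρ * ‖v‖ := by
      rw [← div_le_iff₀' hρ]; linarith
    have h6 : (K + |m|) * ‖v‖ ≤ ρ * ‖v‖ * ‖v‖ := by gcongr
    have h7 : |m| * 1 ≤ |m| * ‖v‖ := by gcongr; linarith
    nlinarith [hgM v, le_abs_self m]
  calc f u₀ + (g u₀ : EReal) = ((a + g u₀ : ℝ) : EReal) := by rw [ha, EReal.coe_add]
    _ ≤ ((c + L v + g v : ℝ) : EReal) := EReal.coe_le_coe_iff.2 h1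
    _ ≤ f v + (g v : EReal) := by
      rw [EReal.coe_add]; exact add_le_add_left (hfL v) _

end Minimization

variable {V : Type*} {G : SimpleGraph V} {n : ℕ}

/-! ### The space of edge variables and the swap. -/

section EdgeVec

variable (G n) in
/-- The edge variables, as a Euclidean space. -/
abbrev EdgeSpace : Type _ := PiLp 2 fun _ : G.Dart => WithLp 2 (E n × E n)

variable (G n) in
/-- The identification of the edge variables with the Euclidean space that they form. -/
noncomputable def toEdgeSpace : EdgeVec G n ≃ₗ[ℝ] EdgeSpace G n :=
  (LinearEquiv.piCongrRight fun _ => (WithLp.linearEquiv 2 ℝ (E n × E n)).symm) ≪≫ₗ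
    (WithLp.linearEquiv 2 ℝ (G.Dart → WithLp 2 (E n × E n))).symm

theorem continuous_toEdgeSpace_symm : Continuous (toEdgeSpace G n).symm :=
  continuous_pi fun d => (WithLp.prod_continuous_ofLp 2 (E n) (E n)).comp
    ((continuous_apply d).comp (PiLp.continuous_ofLp 2 _))

theorem swapEdges_swapEdges (y : EdgeVec G n) : swapEdges (swapEdges y) = y := by
  ext d : 1; simp [swapEdges]

theorem swapEdges_zero : swapEdges (0 : EdgeVec G n) = 0 := rfl

theorem swapEdges_add (y y' : EdgeVec G n) :
    swapEdges (y + y') = swapEdges y + swapEdges y' := rfl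

theorem swapEdges_sub (y y' : EdgeVec G n) :
    swapEdges (y - y') = swapEdges y - swapEdges y' := rfl

theorem swapEdges_neg (y : EdgeVec G n) : swapEdges (-y) = -swapEdges y := rfl

theorem swapEdges_smul (c : ℝ) (y : EdgeVec G n) : swapEdges (c • y) = c • swapEdges y := rfl

theorem edgeMap_sub (x x' : Copies G n) : edgeMap (x - x') = edgeMap x - edgeMap x' := by
  funext d
  ext <;> simp [edgeMap] <;> ring

end EdgeVec

variable [Fintype V] [DecidableRel G.Adj]

/-! ### Inner products of edge variables. -/

section EdgeSpace

theorem inner_toEdgeSpace (w y : EdgeVec G n) :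
    inner ℝ (toEdgeSpace G n w) (toEdgeSpace G n y) = edgeInner w y := by
  simp only [PiLp.inner_apply, WithLp.prod_inner_apply, edgeInner]
  rfl

theorem eq_zero_of_edgeInner_self_nonpos {y : EdgeVec G n} (h : edgeInner y y ≤ 0) : y = 0 := by
  rw [← inner_toEdgeSpace, real_inner_self_nonpos] at h
  simpa using h

theorem edgeInner_add_left (w w' y : EdgeVec G n) :
    edgeInner (w + w') y = edgeInner w y + edgeInner w' y := by
  simp only [← inner_toEdgeSpace, map_add, inner_add_left]

theorem edgeInner_sub_left (w w' y : EdgeVec G n) :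
    edgeInner (w - w') y = edgeInner w y - edgeInner w' y := by
  simp only [← inner_toEdgeSpace, map_sub, inner_sub_left]

theorem edgeInner_neg_left (w y : EdgeVec G n) : edgeInner (-w) y = -edgeInner w y := by
  simp only [← inner_toEdgeSpace, map_neg, inner_neg_left]

theorem edgeInner_zero_right (w : EdgeVec G n) : edgeInner w 0 = 0 := by
  simp only [← inner_toEdgeSpace, map_zero, inner_zero_right]

theorem edgeInner_smul_right (c : ℝ) (w y : EdgeVec G n) :
    edgeInner w (c • y) = c * edgeInner w y := by
  simp only [← inner_toEdgeSpace, map_smul, inner_smul_right]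

theorem edgeInner_swapEdges (w y : EdgeVec G n) :
    edgeInner (swapEdges w) (swapEdges y) = edgeInner w y := by
  unfold edgeInner swapEdges
  refine Fintype.sum_equiv ⟨SimpleGraph.Dart.symm, SimpleGraph.Dart.symm,
    SimpleGraph.Dart.symm_symm, SimpleGraph.Dart.symm_symm⟩ _ _ fun d => ?_
  exact add_comm _ _

theorem norm_toEdgeSpace_swapEdges (y : EdgeVec G n) :
    ‖toEdgeSpace G n (swapEdges y)‖ = ‖toEdgeSpace G n y‖ := by
  rw [← sq_eq_sq₀ (norm_nonneg _) (norm_nonneg _), ← real_inner_self_eq_norm_sq,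
    ← real_inner_self_eq_norm_sq, inner_toEdgeSpace, inner_toEdgeSpace, edgeInner_swapEdges]

/-- The swap is an isometry, so its eigenspaces for `-1` and `1` are orthogonal. -/
theorem edgeInner_eq_zero_of_swapEdges {w y : EdgeVec G n} (hw : swapEdges w = -w)
    (hy : swapEdges y = y) : edgeInner w y = 0 := by
  have := edgeInner_swapEdges w y
  rw [hw, hy, edgeInner_neg_left] at this
  linarith

theorem sum_darts {M : Type*} [AddCommMonoid M] (φ : G.Dart → M) :
    ∑ d, φ d = ∑ i, ∑ j : G.neighborSet i, φ (G.dartOfNeighborSet i j) := by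
  rw [← Fintype.sum_sigma']
  exact Fintype.sum_equiv
    { toFun := fun d => (⟨d.fst, d.snd, d.adj⟩ : Σ i, G.neighborSet i)
      invFun := fun p => G.dartOfNeighborSet p.1 p.2
      left_inv := fun _ => rfl
      right_inv := fun _ => rfl } _ _ fun _ => rfl

end EdgeSpace

/-! ### Local subgradients, optimality and saddle points. -/

section LocalPairing

/-- The part of `-⟨s, A x⟩` that belongs to the local copies of node `i`. -/
noncomputable def localPairing (s : EdgeVec G n) (i : V) : LocalVec G n i →ₗ[ℝ] ℝ :=
  ∑ j : G.neighborSet i,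
    (innerₗ (E n) (s (G.dartOfNeighborSet i j)).1 ∘ₗ LinearMap.fst ℝ _ _ +
      innerₗ (E n) (s (G.dartOfNeighborSet i j)).2 ∘ₗ LinearMap.proj j ∘ₗ LinearMap.snd ℝ _ _)

theorem localPairing_apply (s : EdgeVec G n) (i : V) (u : LocalVec G n i) :
    localPairing s i u = ∑ j : G.neighborSet i,
      (inner ℝ (s (G.dartOfNeighborSet i j)).1 u.1 +
        inner ℝ (s (G.dartOfNeighborSet i j)).2 (u.2 j)) := by
  simp [localPairing]

theorem localPairing_sub (s s' : EdgeVec G n) (i : V) (u : LocalVec G n i) :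
    localPairing (s - s') i u = localPairing s i u - localPairing s' i u := by
  simp only [localPairing_apply, ← Finset.sum_sub_distrib, Pi.sub_apply, Prod.fst_sub,
    Prod.snd_sub, inner_sub_left]
  exact Finset.sum_congr rfl fun j _ => by ring

theorem localPairing_neg (s : EdgeVec G n) (i : V) (u : LocalVec G n i) :
    localPairing (-s) i u = -localPairing s i u := by
  simpa [localPairing_apply] using localPairing_sub 0 s i u

theorem localPairing_add_smul (s s' : EdgeVec G n) (c : ℝ) (i : V) (u : LocalVec G n i) :
    localPairing (s + c • s') i u = localPairing s i u + c * localPairing s' i u := by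
  simp only [localPairing_apply, Finset.mul_sum, ← Finset.sum_add_distrib, Pi.add_apply,
    Pi.smul_apply, Prod.fst_add, Prod.snd_add, Prod.smul_fst, Prod.smul_snd, inner_add_left,
    real_inner_smul_left]
  exact Finset.sum_congr rfl fun j _ => by ring

theorem edgeInner_edgeMap (s : EdgeVec G n) (x : Copies G n) :
    edgeInner s (edgeMap x) = -∑ i, localPairing s i (x i) := by
  simp only [edgeInner, localPairing_apply]
  rw [sum_darts, ← Finset.sum_neg_distrib]
  refine Finset.sum_congr rfl fun i _ => ?_
  rw [← Finset.sum_neg_distrib]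
  refine Finset.sum_congr rfl fun j _ => ?_
  simp only [edgeMap, inner_neg_right]
  rw [neg_add]
  rfl

/-- The squared norm of the local copies of node `i`, each counted once for every edge. -/
noncomputable def localSq (i : V) (u : LocalVec G n i) : ℝ :=
  ∑ j : G.neighborSet i, (‖u.1‖ ^ 2 + ‖u.2 j‖ ^ 2)

theorem continuous_localSq (i : V) : Continuous (localSq (G := G) (n := n) i) := by
  unfold localSq; fun_prop

theorem localSq_add_smul (x : Copies G n) (i : V) (t : ℝ) (v : LocalVec G n i) :
    localSq i (x i + t • v) =
      localSq i (x i) - 2 * t * localPairing (edgeMap x) i v + t ^ 2 * localSq i v := by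
  simp only [localSq, localPairing_apply, Finset.mul_sum, ← Finset.sum_add_distrib,
    ← Finset.sum_sub_distrib]
  refine Finset.sum_congr rfl fun j _ => ?_
  have h1 : (edgeMap x (G.dartOfNeighborSet i j)).1 = -(x i).1 := rfl
  have h2 : (edgeMap x (G.dartOfNeighborSet i j)).2 = -(x i).2 j := rfl
  simp only [h1, h2, Prod.fst_add, Prod.smul_fst, Prod.snd_add, Prod.smul_snd, Pi.add_apply,
    Pi.smul_apply, norm_add_sq_real, inner_neg_left, real_inner_smul_right, norm_smul, mul_pow,
    Real.norm_eq_abs, sq_abs]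
  ring

/-- With a neighbor, every local variable appears in some summand; the norm of `LocalVec` is a
maximum, so no constant is lost. -/
theorem norm_sq_le_localSq {i : V} (hi : G.degree i ≠ 0) (u : LocalVec G n i) :
    ‖u‖ ^ 2 ≤ localSq i u := by
  have h0 : 0 ≤ localSq i u := Finset.sum_nonneg fun j _ => by positivity
  have hj : ∀ j, ‖u.1‖ ^ 2 + ‖u.2 j‖ ^ 2 ≤ localSq i u := fun j =>
    Finset.single_le_sum (f := fun j => ‖u.1‖ ^ 2 + ‖u.2 j‖ ^ 2)
      (fun j _ => by positivity) (Finset.mem_univ j)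
  obtain ⟨j₀, hj₀⟩ := (G.degree_pos_iff_exists_adj i).1 (Nat.pos_of_ne_zero hi)
  rw [← Real.le_sqrt (norm_nonneg _) h0, norm_prod_le_iff,
    pi_norm_le_iff_of_nonneg (Real.sqrt_nonneg _)]
  refine ⟨?_, fun j => ?_⟩
  · rw [Real.le_sqrt (norm_nonneg _) h0]
    have := hj ⟨j₀, hj₀⟩
    nlinarith [sq_nonneg ‖u.2 ⟨j₀, hj₀⟩‖]
  · rw [Real.le_sqrt (norm_nonneg _) h0]
    nlinarith [hj j, sq_nonneg ‖u.1‖]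

variable (f : (i : V) → LocalVec G n i → EReal)

/-- The swap appears because node `i` reads `z` at `(j, i)`, while `localPairing` reads edges
leaving `i`. -/
theorem localObjective_eq (ρ : ℝ) (z : EdgeVec G n) (i : V) :
    localObjective f ρ z i = fun u => f i u +
      ((-localPairing (swapEdges z) i u + ρ / 2 * localSq i u : ℝ) : EReal) := by
  funext u
  unfold localObjective
  congr 2
  have h1 : localPairing (swapEdges z) i u =
      inner ℝ (∑ j : G.neighborSet i, (z ⟨(↑j, i), SimpleGraph.Adj.symm j.2⟩).2) u.1 +
      ∑ j : G.neighborSet i, inner ℝ (z ⟨(↑j, i), SimpleGraph.Adj.symm j.2⟩).1 (u.2 j) := by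
    rw [localPairing_apply, sum_inner, Finset.sum_add_distrib]
    rfl
  have h2 : localSq i u = (G.degree i : ℝ) * ‖u.1‖ ^ 2 + ∑ j : G.neighborSet i, ‖u.2 j‖ ^ 2 := by
    rw [localSq, Finset.sum_add_distrib, Finset.sum_const, Finset.card_univ,
      SimpleGraph.card_neighborSet_eq_degree, nsmul_eq_mul]
  rw [h1, h2]
  ring

theorem localObjective_eq_of_degree_eq_zero (ρ : ℝ) (z : EdgeVec G n) {i : V}
    (hi : G.degree i = 0) : localObjective f ρ z i = f i := by
  have : IsEmpty (G.neighborSet i) := by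
    rw [← Fintype.card_eq_zero_iff, SimpleGraph.card_neighborSet_eq_degree, hi]
  rw [localObjective_eq]
  funext u
  simp [localPairing_apply, localSq]

/-- `s` is, at node `i`, a subgradient of `f i` at the local copies `u`. -/
def IsLocalSubgradient (s : EdgeVec G n) (i : V) (u : LocalVec G n i) : Prop :=
  f i u ≠ ⊤ ∧ ∀ v, f i u + (localPairing s i (v - u) : EReal) ≤ f i v

variable {f} (hf : ∀ i, ClosedProperConvex (f i))
include hf

/-- The quadratic term has gradient `-ρ A x`, because `edgeMap` carries a minus sign. -/
theorem isLocalSubgradient_of_isArgmin {ρ : ℝ} {z : EdgeVec G n} {x : Copies G n} {i : V}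
    (hx : IsArgmin (localObjective f ρ z i) (x i)) :
    IsLocalSubgradient f (swapEdges z + ρ • edgeMap x) i (x i) := by
  rw [localObjective_eq] at hx
  refine ⟨(hf i).ne_top_of_isArgmin_add hx, fun v => ?_⟩
  have := (hf i).le_of_isArgmin_add (v := v)
    (D := -localPairing (swapEdges z + ρ • edgeMap x) i (v - x i))
    (C := ρ / 2 * localSq i (v - x i)) hx fun t _ _ => by
      rw [localSq_add_smul, localPairing_add_smul, map_add, map_smul, smul_eq_mul]
      apply le_of_eq
      ring
  simpa using this

/-- Monotonicity of the subdifferential: add the two subgradient inequalities at each node. -/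
theorem edgeInner_nonneg_of_isLocalSubgradient {s s' : EdgeVec G n} {x x' : Copies G n}
    (h : ∀ i, IsLocalSubgradient f s i (x i)) (h' : ∀ i, IsLocalSubgradient f s' i (x' i)) :
    0 ≤ edgeInner (s - s') (edgeMap x' - edgeMap x) := by
  rw [← edgeMap_sub, edgeInner_edgeMap, neg_nonneg]
  refine Finset.sum_nonpos fun i _ => ?_
  obtain ⟨a, ha⟩ := (hf i).exists_coe (h i).1
  obtain ⟨b, hb⟩ := (hf i).exists_coe (h' i).1
  have h1 := (h i).2 (x' i)
  have h2 := (h' i).2 (x i)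
  rw [ha, hb, ← EReal.coe_add, EReal.coe_le_coe_iff] at h1 h2
  rw [localPairing_sub, Pi.sub_apply]
  rw [← neg_sub, map_neg] at h2
  linarith

/-- The subgradient gives an affine minorant, and the quadratic term gives coercivity. At a node
without neighbors the pairing is empty, so `x i` itself is a minimizer. -/
theorem exists_isArgmin_localObjective {ρ : ℝ} (hρ : 0 < ρ) (z : EdgeVec G n) {s : EdgeVec G n}
    {x : Copies G n} (h : ∀ i, IsLocalSubgradient f s i (x i)) (i : V) :
    ∃ u, IsArgmin (localObjective f ρ z i) u := by
  rcases eq_or_ne (G.degree i) 0 with hi | hi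
  · rw [localObjective_eq_of_degree_eq_zero f ρ z hi]
    have : IsEmpty (G.neighborSet i) := by
      rw [← Fintype.card_eq_zero_iff, SimpleGraph.card_neighborSet_eq_degree, hi]
    refine ⟨x i, fun v => ?_⟩
    simpa [localPairing_apply] using (h i).2 v
  · rw [localObjective_eq]
    obtain ⟨a, ha⟩ := (hf i).exists_coe (h i).1
    refine (hf i).exists_isArgmin_add (L := localPairing s i) (M := -localPairing (swapEdges z) i)
      (c := a - localPairing s i (x i)) (ρ := ρ / 2) ?_ (by positivity) (fun u => ?_) fun u => ?_
    · have h1 : Continuous (localPairing (swapEdges z) i) :=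
        LinearMap.continuous_of_finiteDimensional _
      have h2 := continuous_localSq (G := G) (n := n) i
      fun_prop
    · have := (h i).2 u
      rw [ha, ← EReal.coe_add, map_sub] at this
      convert this using 2
      ring
    · have := norm_sq_le_localSq hi u
      simp only [LinearMap.neg_apply]
      gcongr

theorem isOptimal_of_isLocalSubgradient {s : EdgeVec G n} {x : V → E n}
    (hs : swapEdges s = -s)
    (h : ∀ i, IsLocalSubgradient f s i (x i, fun j => x j)) : IsOptimal f x := by
  choose r hr using fun i => (hf i).exists_coe (h i).1
  have hsum : partitionCost f x = ((∑ i, r i : ℝ) : EReal) := sum_eq_coe hr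
  refine ⟨by rw [hsum]; exact EReal.coe_ne_top _, fun x' => ?_⟩
  rcases eq_or_ne (partitionCost f x') ⊤ with ht | ht
  · rw [ht]; exact le_top
  obtain ⟨r', hr'⟩ := exists_coe_of_sum_ne_top (fun i => (hf i).ne_bot _) ht
  have hsum' : partitionCost f x' = ((∑ i, r' i : ℝ) : EReal) := sum_eq_coe hr'
  rw [hsum, hsum', EReal.coe_le_coe_iff]
  set c : Copies G n := fun i => (x' i - x i, fun j => x' j - x j) with hc
  -- `c` consists of copies of the global vector `x' - x`, so `A c` is swap-invariant by definition.
  have hc0 : edgeInner s (edgeMap c) = 0 := edgeInner_eq_zero_of_swapEdges hs rfl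
  rw [edgeInner_edgeMap, neg_eq_zero] at hc0
  have : ∑ i, (r i + localPairing s i (c i)) ≤ ∑ i, r' i := by
    refine Finset.sum_le_sum fun i _ => ?_
    have h1 := (h i).2 (x' i, fun j => x' j)
    rw [hr, hr', ← EReal.coe_add, EReal.coe_le_coe_iff] at h1
    exact h1
  rwa [Finset.sum_add_distrib, hc0, add_zero] at this

theorem exists_isLocalSubgradient_of_isSaddlePoint {x : Copies G n} {y w : EdgeVec G n}
    (h : IsSaddlePoint f x y w) :
    swapEdges (edgeMap x) = edgeMap x ∧ swapEdges w = -w ∧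
      ∀ i, IsLocalSubgradient f (-w) i (x i) := by
  classical
  obtain ⟨h1, h2⟩ := h
  have hlag : ∀ (x' : Copies G n) (y' w' : EdgeVec G n) (r : V → ℝ), (∀ i, f i (x' i) = r i) →
      swapEdges y' = y' → lagrangian f x' y' w' =
        ((∑ i, r i - edgeInner w' (edgeMap x' + y') : ℝ) : EReal) := by
    intro x' y' w' r hr hy'
    rw [lagrangian, copiesCost, sum_eq_coe hr, bridgeIndicator, if_pos hy'.symm, add_zero,
      ← EReal.coe_add, sub_eq_add_neg]
  have hfin : lagrangian f x y w ≠ ⊤ := by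
    choose x' hx' using fun i => (hf i).exists_ne_top
    choose r hr using fun i => (hf i).exists_coe (hx' i)
    refine ne_top_of_le_ne_top ?_ (h2 x' 0)
    rw [hlag x' 0 w r hr swapEdges_zero]
    exact EReal.coe_ne_top _
  have hx : copiesCost f x ≠ ⊤ := by
    intro ht
    apply hfin
    rw [lagrangian, ht, EReal.top_add_of_ne_bot, EReal.top_add_coe]
    unfold bridgeIndicator
    split_ifs <;> simp
  obtain ⟨r, hr⟩ := exists_coe_of_sum_ne_top (fun i => (hf i).ne_bot _) hx
  have hy : swapEdges y = y := by
    by_contra hy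
    apply hfin
    rw [lagrangian, copiesCost, sum_eq_coe hr, bridgeIndicator, if_neg (Ne.symm hy),
      EReal.coe_add_top, EReal.top_add_coe]
  have hfeas : edgeMap x + y = 0 := by
    apply eq_zero_of_edgeInner_self_nonpos
    -- Moving the multiplier against the residual shows that the residual has nonpositive squared
    -- norm.
    have := h1 (w - (edgeMap x + y))
    rw [hlag x y _ r hr hy, hlag x y _ r hr hy, EReal.coe_le_coe_iff, edgeInner_sub_left] at this
    linarith
  have hw : swapEdges w = -w := by
    have hb : swapEdges (w + swapEdges w) = w + swapEdges w := by
      rw [swapEdges_add, swapEdges_swapEdges, add_comm]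
    -- The swap-invariant direction `b = w + P w` keeps `y` admissible. Minimality gives `⟨w, b⟩ ≤
    -- 0`, and `⟨P w, b⟩ = ⟨w, b⟩`, so `‖b‖² ≤ 0`.
    have h3 := h2 x (y + (w + swapEdges w))
    rw [hlag x y _ r hr hy, hlag x _ _ r hr (by rw [swapEdges_add, hb, hy]), ← add_assoc, hfeas,
      zero_add, edgeInner_zero_right, EReal.coe_le_coe_iff] at h3
    have h4 := edgeInner_swapEdges w (w + swapEdges w)
    rw [hb] at h4
    have h5 : w + swapEdges w = 0 := by
      apply eq_zero_of_edgeInner_self_nonpos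
      rw [edgeInner_add_left]
      linarith
    exact (neg_eq_of_add_eq_zero_right h5).symm
  refine ⟨?_, hw, fun i => ⟨by rw [hr]; exact EReal.coe_ne_top _, fun v => ?_⟩⟩
  · rw [eq_neg_of_add_eq_zero_left hfeas, swapEdges_neg, hy]
  rcases eq_or_ne (f i v) ⊤ with hv | hv
  · rw [hv]; exact le_top
  obtain ⟨b, hb⟩ := (hf i).exists_coe hv
  have hr' : ∀ k, f k (Function.update x i v k) = (Function.update r i b k : ℝ) := by
    intro k
    rcases eq_or_ne k i with rfl | hk
    · simp [hb]
    · simp [hk, hr]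
  -- Changing the copies of a single node isolates its subgradient inequality.
  have h3 := h2 (Function.update x i v) y
  have h4 : edgeMap (Function.update x i v) + y = edgeMap (Function.update x i v - x) := by
    rw [edgeMap_sub, eq_neg_of_add_eq_zero_right hfeas, sub_eq_add_neg]
  have h5 : ∑ k, localPairing w k ((Function.update x i v - x) k) =
      localPairing w i (v - x i) := by
    rw [Finset.sum_eq_single i (fun k _ hk => by simp [hk]) (by simp)]
    simp
  have h6 : ∑ k, (Function.update r i b k - r k) = b - r i := by
    rw [Finset.sum_eq_single i (fun k _ hk => by simp [hk]) (by simp)]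
    simp
  rw [hlag x y _ r hr hy, hlag _ y _ _ hr' hy, hfeas, h4, edgeInner_zero_right,
    edgeInner_edgeMap, h5, EReal.coe_le_coe_iff] at h3
  rw [Finset.sum_sub_distrib] at h6
  rw [hr, hb, ← EReal.coe_add, EReal.coe_le_coe_iff, localPairing_neg]
  linarith

end LocalPairing

/-! ### The fixed-point operator and convergence of the copies. -/

section Convergence

variable {f : (i : V) → LocalVec G n i → EReal} {α ρ : ℝ}

theorem swapEdges_eq_of_isRun {x : ℕ → Copies G n} {z q : ℕ → EdgeVec G n}
    (h : IsRun f α ρ x z q) (k : ℕ) :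
    swapEdges (z (k + 1)) = (1 - α) • swapEdges (z k) +
      α • swapEdges (-((2 * ρ) • edgeMap (x k)) - swapEdges (z k)) := by
  funext d
  obtain ⟨⟨i, j⟩, hd⟩ := d
  have h1 := h.z_own k i j hd
  have h2 := h.z_nbr k i j hd
  rw [h.q_nbr k j i hd.symm] at h1
  rw [h.q_own k j i hd.symm] at h2
  refine Prod.ext (h1.trans ?_) (h2.trans ?_) <;>
    simp [swapEdges, edgeMap, SimpleGraph.Dart.symm] <;> module

/-- The auxiliary variables after one step of the algorithm, where the local copies are `X z`. -/
noncomputable def edgeStep (α ρ : ℝ) (X : EdgeVec G n → Copies G n) (z : EdgeVec G n) :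
    EdgeVec G n :=
  (1 - α) • z + α • (-((2 * ρ) • edgeMap (X z)) - swapEdges z)

theorem isRun_iterate {X : EdgeVec G n → Copies G n}
    (hX : ∀ z i, IsArgmin (localObjective f ρ z i) (X z i)) (z₀ : EdgeVec G n) :
    IsRun f α ρ (fun k => X ((edgeStep α ρ X)^[k] z₀)) (fun k => (edgeStep α ρ X)^[k] z₀)
      (fun k => -((2 * ρ) • edgeMap (X ((edgeStep α ρ X)^[k] z₀))) -
        swapEdges ((edgeStep α ρ X)^[k] z₀)) where
  x_update k i := hX _ i
  q_own k i j h := by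
    simp [swapEdges, edgeMap, SimpleGraph.Dart.symm]; abel
  q_nbr k i j h := by
    simp [swapEdges, edgeMap, SimpleGraph.Dart.symm]; abel
  z_own k i j h := by
    rw [Function.iterate_succ_apply']; rfl
  z_nbr k i j h := by
    rw [Function.iterate_succ_apply']; rfl

variable (hf : ∀ i, ClosedProperConvex (f i))
include hf

/-- The map `z ↦ -ρ A x`, where `x` holds the minimizers of the local objectives, is firmly
nonexpansive up to the swap of the edges. -/
theorem inner_nonneg_of_isLocalSubgradient (hρ : 0 < ρ) {ζ ζ' : EdgeVec G n} {x x' : Copies G n}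
    (h : ∀ i, IsLocalSubgradient f (ζ + ρ • edgeMap x) i (x i))
    (h' : ∀ i, IsLocalSubgradient f (ζ' + ρ • edgeMap x') i (x' i)) :
    0 ≤ inner ℝ (toEdgeSpace G n (ζ - ζ' - ρ • (edgeMap x' - edgeMap x)))
      (toEdgeSpace G n (ρ • (edgeMap x' - edgeMap x))) := by
  have := edgeInner_nonneg_of_isLocalSubgradient hf h h'
  rw [inner_toEdgeSpace, edgeInner_smul_right]
  refine mul_nonneg hρ.le (this.trans_eq ?_)
  congr 1
  module

/-- Cauchy–Schwarz applied to firm nonexpansiveness. -/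
theorem norm_edgeMap_sub_le (hρ : 0 < ρ) {ζ ζ' : EdgeVec G n} {x x' : Copies G n}
    (h : ∀ i, IsLocalSubgradient f (ζ + ρ • edgeMap x) i (x i))
    (h' : ∀ i, IsLocalSubgradient f (ζ' + ρ • edgeMap x') i (x' i)) :
    ρ * ‖toEdgeSpace G n (edgeMap x) - toEdgeSpace G n (edgeMap x')‖ ≤
      ‖toEdgeSpace G n ζ - toEdgeSpace G n ζ'‖ := by
  have h1 := inner_nonneg_of_isLocalSubgradient hf hρ h h'
  have h2 : ρ * ‖toEdgeSpace G n (edgeMap x) - toEdgeSpace G n (edgeMap x')‖ =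
      ‖toEdgeSpace G n (ρ • (edgeMap x' - edgeMap x))‖ := by
    rw [map_smul, norm_smul, Real.norm_eq_abs, abs_of_pos hρ, map_sub, norm_sub_rev]
  rw [h2, ← map_sub]
  rw [map_sub, inner_sub_left, real_inner_self_eq_norm_sq] at h1
  have h3 := real_inner_le_norm (toEdgeSpace G n (ζ - ζ'))
    (toEdgeSpace G n (ρ • (edgeMap x' - edgeMap x)))
  rcases (norm_nonneg (toEdgeSpace G n (ρ • (edgeMap x' - edgeMap x)))).eq_or_lt with h0 | h0
  · rw [← h0]; exact norm_nonneg _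
  · nlinarith

/-- Makes the choice among several minimizers irrelevant on the edges. -/
theorem edgeMap_eq_of_isLocalSubgradient (hρ : 0 < ρ) {ζ : EdgeVec G n} {x x' : Copies G n}
    (h : ∀ i, IsLocalSubgradient f (ζ + ρ • edgeMap x) i (x i))
    (h' : ∀ i, IsLocalSubgradient f (ζ + ρ • edgeMap x') i (x' i)) :
    edgeMap x = edgeMap x' := by
  have h1 := norm_edgeMap_sub_le hf hρ h h'
  rw [sub_self, norm_zero] at h1
  have h2 : ‖toEdgeSpace G n (edgeMap x) - toEdgeSpace G n (edgeMap x')‖ = 0 :=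
    le_antisymm (nonpos_of_mul_nonpos_right h1 hρ) (norm_nonneg _)
  rwa [norm_eq_zero, sub_eq_zero, EmbeddingLike.apply_eq_iff_eq] at h2

/-- With `‖u‖² ≤ ⟨b, u⟩`, expanding gives `‖2u - b‖² ≤ ‖b‖²`; the swap preserves norms. -/
theorem norm_reflection_sub_le (hρ : 0 < ρ) {ζ ζ' : EdgeVec G n} {x x' : Copies G n}
    (h : ∀ i, IsLocalSubgradient f (ζ + ρ • edgeMap x) i (x i))
    (h' : ∀ i, IsLocalSubgradient f (ζ' + ρ • edgeMap x') i (x' i)) :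
    ‖toEdgeSpace G n (swapEdges (-((2 * ρ) • edgeMap x) - ζ)) -
        toEdgeSpace G n (swapEdges (-((2 * ρ) • edgeMap x') - ζ'))‖ ≤
      ‖toEdgeSpace G n ζ - toEdgeSpace G n ζ'‖ := by
  have h1 := inner_nonneg_of_isLocalSubgradient hf hρ h h'
  set u := toEdgeSpace G n (ρ • (edgeMap x' - edgeMap x)) with hu
  set b := toEdgeSpace G n (ζ - ζ') with hb
  have h2 : toEdgeSpace G n ((-((2 * ρ) • edgeMap x) - ζ) - (-((2 * ρ) • edgeMap x') - ζ')) =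
      (2 : ℝ) • u - b := by
    rw [hu, hb, ← map_smul, ← map_sub]
    congr 1
    module
  rw [← map_sub, ← swapEdges_sub, norm_toEdgeSpace_swapEdges, h2, ← map_sub, ← hb]
  rw [map_sub, inner_sub_left, real_inner_self_eq_norm_sq, ← hb, ← hu, real_inner_comm] at h1
  rw [← sq_le_sq₀ (norm_nonneg _) (norm_nonneg _), norm_sub_sq_real, norm_smul,
    real_inner_smul_left, Real.norm_ofNat]
  linarith

/-- Along every run, the local copies converge on the edges to those of a consensual optimal
solution. -/
theorem exists_tendsto_edgeMap (hsaddle : ∃ x y w, IsSaddlePoint f x y w)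
    (hα0 : 0 < α) (hα1 : α < 1) (hρ : 0 < ρ) {x : ℕ → Copies G n} {z q : ℕ → EdgeVec G n}
    (hrun : IsRun f α ρ x z q) :
    ∃ (xl : Copies G n) (zl : EdgeVec G n), (∀ i, IsArgmin (localObjective f ρ zl i) (xl i)) ∧
      (∀ i (j : G.neighborSet i), (xl i).2 j = (xl j).1) ∧
      IsOptimal f (fun i => (xl i).1) ∧
      Tendsto (fun k => edgeMap (x k)) atTop (𝓝 (edgeMap xl)) := by
  obtain ⟨xs, ys, w, hs⟩ := hsaddle
  obtain ⟨hxs, hw, hsub⟩ := exists_isLocalSubgradient_of_isSaddlePoint hf hs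
  choose X hX using fun z i => exists_isArgmin_localObjective hf hρ z hsub i
  have hXs : ∀ ζ i, IsLocalSubgradient f (ζ + ρ • edgeMap (X (swapEdges ζ))) i
      (X (swapEdges ζ) i) := fun ζ i => by
    have := isLocalSubgradient_of_isArgmin hf (hX (swapEdges ζ) i)
    rwa [swapEdges_swapEdges] at this
  have hsub' : ∀ i, IsLocalSubgradient f
      ((-w - ρ • edgeMap xs) + ρ • edgeMap xs) i (xs i) := fun i => by
    rw [sub_add_cancel]; exact hsub i
  set e := toEdgeSpace G n with he
  set T : EdgeSpace G n → EdgeSpace G n := fun h =>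
    e (swapEdges (-((2 * ρ) • edgeMap (X (swapEdges (e.symm h)))) - e.symm h)) with hT
  have hTne : ∀ a b, ‖T a - T b‖ ≤ ‖a - b‖ := fun a b => by
    simpa [he] using norm_reflection_sub_le hf hρ (hXs (e.symm a)) (hXs (e.symm b))
  -- This point makes `ζ + ρ A xs` equal to `-w`, the subgradient given by the saddle point.
  have hfix : T (e (-w - ρ • edgeMap xs)) = e (-w - ρ • edgeMap xs) := by
    simp only [hT, LinearEquiv.symm_apply_apply]
    rw [edgeMap_eq_of_isLocalSubgradient hf hρ (hXs (-w - ρ • edgeMap xs)) hsub']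
    simp only [swapEdges_sub, swapEdges_neg, swapEdges_smul, hxs, hw]
    congr 1
    module
  have hxk : ∀ k, edgeMap (x k) = edgeMap (X (z k)) := fun k =>
    edgeMap_eq_of_isLocalSubgradient hf hρ
      (fun i => isLocalSubgradient_of_isArgmin hf (hrun.x_update k i))
      (fun i => isLocalSubgradient_of_isArgmin hf (hX (z k) i))
  obtain ⟨l, hl, hlim⟩ := exists_tendsto_averaged_iteration hTne hfix hα0 hα1
    (ζ := fun k => e (swapEdges (z k))) fun k => by
      simp only [hT, LinearEquiv.symm_apply_apply, swapEdges_swapEdges]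
      rw [swapEdges_eq_of_isRun hrun, hxk, map_add, map_smul, map_smul]
  set ζ := e.symm l with hζ
  set xl := X (swapEdges ζ) with hxl
  set y := edgeMap xl with hy
  have hζfix : swapEdges (-((2 * ρ) • y) - ζ) = ζ := by
    rw [hζ, LinearEquiv.eq_symm_apply]; exact hl
  have hswap : swapEdges ζ = -((2 * ρ) • y) - ζ := by
    conv_lhs => rw [← hζfix]
    rw [swapEdges_swapEdges]
  have hyswap : swapEdges y = y := by
    -- Substitute `P ζ = -2 ρ y - ζ` into `-2 ρ P y - P ζ = ζ`.
    have h1 : (2 * ρ) • swapEdges y = (2 * ρ) • y := by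
      rw [swapEdges_sub, swapEdges_neg, swapEdges_smul, hswap] at hζfix
      have := congrArg (fun t => (2 * ρ) • swapEdges y + t + (2 * ρ) • y - ζ) hζfix
      rw [← sub_eq_zero] at this ⊢
      rw [← neg_eq_zero, ← this]
      module
    exact smul_right_injective _ (by positivity : (2 * ρ) ≠ 0) h1
  have hcons : ∀ i (j : G.neighborSet i), (xl i).2 j = (xl j).1 := by
    intro i j
    have := congrArg Prod.snd (congrFun hyswap (G.dartOfNeighborSet i j))
    simpa [hy, swapEdges, edgeMap, SimpleGraph.dartOfNeighborSet, SimpleGraph.Dart.symm]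
      using this.symm
  refine ⟨xl, swapEdges ζ, hX _, hcons, ?_, ?_⟩
  · refine isOptimal_of_isLocalSubgradient hf (s := ζ + ρ • y) ?_ fun i => ?_
    · rw [swapEdges_add, swapEdges_smul, hyswap, hswap]
      module
    · have h1 : ((xl i).1, fun j : G.neighborSet i => (xl j).1) = xl i :=
        Prod.ext rfl (funext fun j => (hcons i j).symm)
      rw [h1]
      exact hXs ζ i
  · have h1 : Tendsto (fun k => e (edgeMap (x k))) atTop (𝓝 (e y)) := by
      rw [tendsto_iff_norm_sub_tendsto_zero] at hlim ⊢
      have h2 := hlim.const_mul ρ⁻¹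
      rw [mul_zero] at h2
      refine squeeze_zero (fun _ => norm_nonneg _) (fun k => ?_) h2
      rw [le_inv_mul_iff₀ hρ]
      have := norm_edgeMap_sub_le hf hρ
        (fun i => isLocalSubgradient_of_isArgmin hf (hrun.x_update k i)) (hXs ζ)
      simpa [he, hζ] using this
    have h2 := (continuous_toEdgeSpace_symm.tendsto _).comp h1
    simpa only [Function.comp_def, he, LinearEquiv.symm_apply_apply] using h2

theorem exists_copiesTendTo (hsaddle : ∃ x y w, IsSaddlePoint f x y w)
    (hα0 : 0 < α) (hα1 : α < 1) (hρ : 0 < ρ)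
    (hiso : ∀ i, G.degree i = 0 → ∀ u v, IsArgmin (f i) u → IsArgmin (f i) v → u = v)
    {x : ℕ → Copies G n} {z q : ℕ → EdgeVec G n} (hrun : IsRun f α ρ x z q) :
    ∃ xs, IsOptimal f xs ∧ CopiesTendTo x xs := by
  obtain ⟨xl, zl, hxl, hcons, hopt, hlim⟩ := exists_tendsto_edgeMap hf hsaddle hα0 hα1 hρ hrun
  have hd : ∀ i (j : G.neighborSet i), Tendsto (fun k => (x k i).1) atTop (𝓝 (xl i).1) ∧
      Tendsto (fun k => (x k i).2 j) atTop (𝓝 ((xl i).2 j)) := by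
    intro i j
    have h1 := ((continuous_apply (G.dartOfNeighborSet i j)).tendsto _).comp hlim
    have h2 := ((continuous_fst.tendsto _).comp h1).neg
    have h3 := ((continuous_snd.tendsto _).comp h1).neg
    constructor
    · simpa [Function.comp_def, edgeMap, SimpleGraph.dartOfNeighborSet] using h2
    · simpa [Function.comp_def, edgeMap, SimpleGraph.dartOfNeighborSet] using h3
  refine ⟨_, hopt, fun i => ⟨?_, fun j => ?_⟩⟩
  · rcases eq_or_ne (G.degree i) 0 with hi | hi
    · have h1 : ∀ k, x k i = xl i := fun k => by
        have h2 := hrun.x_update k i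
        have h3 := hxl i
        rw [localObjective_eq_of_degree_eq_zero f ρ _ hi] at h2 h3
        exact hiso i hi _ _ h2 h3
      simp only [h1]
      exact tendsto_const_nhds
    · obtain ⟨j, hj⟩ := (G.degree_pos_iff_exists_adj i).1 (Nat.pos_of_ne_zero hi)
      exact (hd i ⟨j, hj⟩).1
  · rw [← hcons]
    exact (hd i j).2

omit hf in
/-- If the optimal solution is unique, the cost of a node without neighbors has at most one
minimizer. -/
theorem eq_of_isArgmin_of_unique {xs : V → E n} (hxs : IsOptimal f xs)
    (huniq : ∀ x', IsOptimal f x' → x' = xs) {i : V} (hi : G.degree i = 0) {u v : LocalVec G n i}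
    (hu : IsArgmin (f i) u) (hv : IsArgmin (f i) v) : u = v := by
  classical
  have : IsEmpty (G.neighborSet i) := by
    rw [← Fintype.card_eq_zero_iff, SimpleGraph.card_neighborSet_eq_degree, hi]
  -- No other term of the cost sees the variable of a node without neighbors, so putting a minimizer
  -- there preserves optimality.
  have key : ∀ u, IsArgmin (f i) u → u.1 = xs i := by
    intro u hu
    have hle : partitionCost f (Function.update xs i u.1) ≤ partitionCost f xs := by
      refine Finset.sum_le_sum fun k _ => ?_
      rcases eq_or_ne k i with rfl | hk
      · rw [Function.update_self]
        convert hu _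
      · have h1 : ∀ j : G.neighborSet k, Function.update xs i u.1 j = xs j := by
          rintro ⟨j, hj⟩
          refine Function.update_of_ne ?_ _ _
          rintro rfl
          exact this.false ⟨k, hj.symm⟩
        simp only [h1, Function.update_of_ne hk]
        exact le_rfl
    have := huniq _ ⟨ne_top_of_le_ne_top hxs.1 hle, fun x' => hle.trans (hxs.2 x')⟩
    simpa using congrFun this i
  exact Prod.ext ((key u hu).trans (key v hv).symm) (Subsingleton.elim _ _)

end Convergence

end PartitionADMM

theorem proposition2 {V : Type*} [Fintype V] (G : SimpleGraph V) [DecidableRel G.Adj] (n : ℕ)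
    (f : (i : V) → PartitionADMM.LocalVec G n i → EReal)
    (hf : ∀ i, PartitionADMM.ClosedProperConvex (f i))
    (hsaddle : ∃ x y w, PartitionADMM.IsSaddlePoint f x y w)
    (α ρ : ℝ) (hα0 : 0 < α) (hα1 : α < 1) (hρ : 0 < ρ)
    (z₀ : PartitionADMM.EdgeVec G n) :
    -- the algorithm can be run from the initial condition
    (∃ x z q, PartitionADMM.IsRun f α ρ x z q ∧ z 0 = z₀) ∧
    -- every run from it converges to the optimal solution, whenever this is unique
    (∀ x z q, PartitionADMM.IsRun f α ρ x z q → z 0 = z₀ →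
      ∀ xs, PartitionADMM.IsOptimal f xs →
        (∀ x', PartitionADMM.IsOptimal f x' → x' = xs) →
        PartitionADMM.CopiesTendTo x xs) ∧
    -- without uniqueness it converges to some optimal solution, provided that the cost of each
    -- node without neighbors has at most one minimizer
    ((∀ i, G.degree i = 0 →
        ∀ u v, PartitionADMM.IsArgmin (f i) u → PartitionADMM.IsArgmin (f i) v → u = v) →
      ∀ x z q, PartitionADMM.IsRun f α ρ x z q → z 0 = z₀ →
        ∃ xs, PartitionADMM.IsOptimal f xs ∧ PartitionADMM.CopiesTendTo x xs) := by
  refine ⟨?_, fun x z q hrun _ xs hxs huniq => ?_, fun hiso x z q hrun _ =>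
    PartitionADMM.exists_copiesTendTo hf hsaddle hα0 hα1 hρ hiso hrun⟩
  · obtain ⟨xs, ys, w, hs⟩ := hsaddle
    obtain ⟨-, -, hsub⟩ := PartitionADMM.exists_isLocalSubgradient_of_isSaddlePoint hf hs
    choose X hX using fun z i => PartitionADMM.exists_isArgmin_localObjective hf hρ z hsub i
    exact ⟨_, _, _, PartitionADMM.isRun_iterate hX z₀, rfl⟩
  · obtain ⟨xl, hxl, hlim⟩ := PartitionADMM.exists_copiesTendTo hf hsaddle hα0 hα1 hρ
      (fun i hi u v hu hv => PartitionADMM.eq_of_isArgmin_of_unique hxs huniq hi hu hv) hrun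
    rwa [huniq xl hxl] at hlim
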